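/- Let $A=(A_1,\dots,A_g)$ and $B=(B_1,\dots,B_h)$ be tuples of real symmetric $d\times d$ matrices. For tuples $C=(C_1,\dots,C_k)$ of $r\times r$ matrices and $X=(X_1,\dots,X_k)$ of $n\times n$ matrices put $$\Lambda_C(X)=\sum_{i=1}^k C_i\otimes X_i,\qquad L_C(X)=I_r\otimes I_n-\Lambda_C(X).$$ For each $n$ let $\mathrm{proj}_x\mathcal D_{(A,B)}(n)$ be the set of $g$-tuples $X$ of real symmetric $n\times n$ matrices for which there is an $h$-tuple $Y$ of real symmetric $n\times n$ matrices with $I_d\otimes I_n-\Lambda_A(X)-\Lambda_B(Y)\succeq 0$. Assume that the free spectrahedrop $\mathrm{proj}_x\mathcal D_{(A,B)}=\bigcup_n\mathrm{proj}_x\mathcal D_{(A,B)}(n)$ is closed (each level $\mathrm{proj}_x\mathcal D_{(A,B)}(n)$ is closed) and bounded (there is a real $C$ such that $C I_n-\sum_{i=1}^g X_i^2\succeq 0$ for all $n$ and all $X\in\mathrm{proj}_x\mathcal D_{(A,B)}(n)$). For a $d\times d$ matrix $M$ let $M^{\oplus N}$ be the direct sum of $N$ copies of $M$, and for a tuple $C$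 of $d\times d$ matrices write $W^*C^{\oplus N}W$ for the tuple with entries $W^*C_i^{\oplus N}W$. Define $$\mathcal Z_B(n)=\{W\in M_{nd^2\times n}(\mathbb R): W^*B^{\oplus nd}W=0\},$$ $$\mathcal I_B(n,r)=\{W\in M_{nd^2\times r}(\mathbb R): W^*B^{\oplus nd}W=0,\ W^*W=I_r\},\qquad \mathcal I_B(n)=\bigcup_{r\le n}\mathcal I_B(n,r).$$ Let $X$ be a $g$-tuple of real symmetric $n\times n$ matrices. Then: 1. $X\in\mathrm{proj}_x\mathcal D_{(A,B)}(n)$ if and only if $W^*W\otimes I_n-\Lambda_{W^*A^{\oplus nd}W}(X)\succeq 0$ for all $W\in\mathcal Z_B(n)$. 2. $X\in\mathrm{proj}_x\mathcal D_{(A,B)}(n)$ if and only if $L_{W^*A^{\oplus nd}W}(X)\succeq 0$ for all $W\in\mathcal I_B(n)$. 3. If $X\in\mathrm{proj}_x\mathcal D_{(A,B)}(n)$, then $L_{W^*A^{\oplus md}W}(X)\succeq 0$ for all $m\in\mathbb N$ and all $W\in\mathcal I_B(m)$. -/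

import Mathlib

open scoped Kronecker Matrix

/-- `Λ_A(X) = ∑ i, A i ⊗ X i`, the homogeneous linear part of the monic pencil with
coefficients `A`, evaluated at the matrix tuple `X`. -/
noncomputable def linearPart {ι m k : Type*} [Fintype ι]
    (A : ι → Matrix m m ℝ) (X : ι → Matrix k k ℝ) : Matrix (m × k) (m × k) ℝ :=
  ∑ i, A i ⊗ₖ X i

/-- `L_A(X) = I ⊗ I - ∑ i, A i ⊗ X i`, the evaluation at `X` of the monic linear pencil with
coefficients `A`. -/
noncomputable def monicPencil {ι m k : Type*} [Fintype ι] [DecidableEq m] [DecidableEq k]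
    (A : ι → Matrix m m ℝ) (X : ι → Matrix k k ℝ) : Matrix (m × k) (m × k) ℝ :=
  (1 : Matrix m m ℝ) ⊗ₖ (1 : Matrix k k ℝ) - linearPart A X

/-- The set of tuples of self-adjoint (real symmetric) `n × n` matrices. -/
def selfAdjointTuples (ι : Type*) (n : ℕ) : Set (ι → Matrix (Fin n) (Fin n) ℝ) :=
  {X | ∀ i, (X i).IsHermitian}

/-- The level `n` of the free spectrahedron of `A`: the tuples `X` of self-adjoint `n × n`
matrices such that `L_A(X)` is positive semidefinite. -/
def freeSpectrahedron {ι : Type*} [Fintype ι] {d : ℕ} (A : ι → Matrix (Fin d) (Fin d) ℝ)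
    (n : ℕ) : Set (ι → Matrix (Fin n) (Fin n) ℝ) :=
  {X | X ∈ selfAdjointTuples ι n ∧ (monicPencil A X).PosSemidef}

/-- The level `n` of the free spectrahedrop `proj_x D_(A,B)`. A `(g + h)`-tuple `(A, B)` is
represented as the family `Sum.elim A B` indexed by `Fin g ⊕ Fin h`. -/
def freeSpectrahedrop {g h d : ℕ} (A : Fin g → Matrix (Fin d) (Fin d) ℝ)
    (B : Fin h → Matrix (Fin d) (Fin d) ℝ) (n : ℕ) :
    Set (Fin g → Matrix (Fin n) (Fin n) ℝ) :=
  {X | X ∈ selfAdjointTuples (Fin g) n ∧ ∃ Y ∈ selfAdjointTuples (Fin h) n,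
    Sum.elim X Y ∈ freeSpectrahedron (Sum.elim A B) n}

/-- A dimension-free set (given by its levels) is closed if each level is closed. -/
def IsFreeClosed {g : ℕ} (K : (n : ℕ) → Set (Fin g → Matrix (Fin n) (Fin n) ℝ)) : Prop :=
  ∀ n, 0 < n → IsClosed (K n)

/-- A dimension-free set is bounded if, for one real constant `C`, the matrix
`C I - ∑ i, (X i) ^ 2` is positive semidefinite for all its elements `X`, at all levels. -/
def IsFreeBounded {g : ℕ} (K : (n : ℕ) → Set (Fin g → Matrix (Fin n) (Fin n) ℝ)) : Prop :=
  ∃ C : ℝ, ∀ n, 0 < n → ∀ X ∈ K n,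
    (C • (1 : Matrix (Fin n) (Fin n) ℝ) - ∑ i, X i ^ 2).PosSemidef

/-- The direct sum `M^{⊕ N}` of `N` copies of a `d × d` matrix `M`, as the block diagonal matrix
on the index set `Fin d × Fin N`, whose second component numbers the copies. -/
def directSumCopies {d : ℕ} (M : Matrix (Fin d) (Fin d) ℝ) (N : ℕ) :
    Matrix (Fin d × Fin N) (Fin d × Fin N) ℝ :=
  Matrix.blockDiagonal fun _ : Fin N => M

/-- The tuple `W* A^{⊕ N} W`, with entries `W* (A i)^{⊕ N} W`, for a linear map
`W : ℝ^r → (ℝ^d)^N`. -/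
def compression {ι : Type*} {d N r : ℕ} (A : ι → Matrix (Fin d) (Fin d) ℝ)
    (W : Matrix (Fin d × Fin N) (Fin r) ℝ) : ι → Matrix (Fin r) (Fin r) ℝ :=
  fun i => Wᴴ * directSumCopies (A i) N * W

/-- `Z_B(n)`: the linear maps `W : ℝ^n → (ℝ^d)^(n d)` with `W* B^{⊕ n d} W = 0`. -/
def setZ {h d : ℕ} (B : Fin h → Matrix (Fin d) (Fin d) ℝ) (n : ℕ) :
    Set (Matrix (Fin d × Fin (n * d)) (Fin n) ℝ) :=
  {W | compression B W = 0}

/-- `I_B(n, r)`: the isometries `W : ℝ^r → (ℝ^d)^(n d)` with `W* B^{⊕ n d} W = 0`. -/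
def setI {h d : ℕ} (B : Fin h → Matrix (Fin d) (Fin d) ℝ) (n r : ℕ) :
    Set (Matrix (Fin d × Fin (n * d)) (Fin r) ℝ) :=
  {W | compression B W = 0 ∧ Wᴴ * W = 1}

/-- `I_B(n)`: the union of the sets `I_B(n, r)` over `r ≤ n`. Its elements have varying numbers
of columns, so an element is a pair of `r` and a matrix with `r` columns. -/
def setIUnion {h d : ℕ} (B : Fin h → Matrix (Fin d) (Fin d) ℝ) (n : ℕ) :
    Set (Σ r : ℕ, Matrix (Fin d × Fin (n * d)) (Fin r) ℝ) :=
  {W | W.1 ≤ n ∧ W.2 ∈ setI B n W.1}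

/-! If `W* B^{⊕N} W = 0`, compressing `I - Λ_A(X) - Λ_B(Y) ⪰ 0` block by block and summing removes
`Y`; this gives every forward direction, for any number of copies.

The converse is cone duality. By `posSemidef_alternative`, `ε I + L_A(X)` dominates some `Λ_B(Y)`
once `tr(P L_A(X)) ≥ 0` for each `P ⪰ 0` orthogonal to the range of `Λ_B`. Write `P = V* V` with `n
d` rows and reshape `V` into `W : ℝ^n → (ℝ^d)^(nd)`. Orthogonality becomes `W* B^{⊕nd} W = 0`, and
`tr(P L_A(X))` is the quadratic form of the compressed pencil at `∑ e_j ⊗ e_j`, hence nonnegative.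
Rescaling by `(1 + ε)⁻¹` and letting `ε → 0` uses closedness. Isometries suffice because `W` factors
through an orthonormal basis of its column space. -/

/-! ### Compressions and elimination of `Y` -/

/-- The block of `W : ℝ^r → (ℝ^d)^N` mapping into the `c`-th copy of `ℝ^d`. -/
def copyBlock {d N r : ℕ} (W : Matrix (Fin d × Fin N) (Fin r) ℝ) (c : Fin N) :
    Matrix (Fin d) (Fin r) ℝ :=
  Matrix.of fun a j => W (a, c) j

theorem compress_directSumCopies {d N r : ℕ} (M : Matrix (Fin d) (Fin d) ℝ)
    (W : Matrix (Fin d × Fin N) (Fin r) ℝ) :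
    Wᴴ * directSumCopies M N * W = ∑ c, (copyBlock W c)ᴴ * M * copyBlock W c := by
  ext j k
  simp only [directSumCopies, Matrix.mul_apply, Matrix.sum_apply, Matrix.conjTranspose_apply,
    Matrix.blockDiagonal_apply, copyBlock, Matrix.of_apply, Fintype.sum_prod_type, star_trivial,
    mul_ite, mul_zero, Finset.sum_ite_eq', Finset.mem_univ, if_true]
  rw [Finset.sum_comm]

theorem directSumCopies_one (d N : ℕ) :
    directSumCopies (1 : Matrix (Fin d) (Fin d) ℝ) N = 1 :=
  Matrix.blockDiagonal_one

theorem compress_kronecker {d N r n : ℕ} (M : Matrix (Fin d) (Fin d) ℝ)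
    (W : Matrix (Fin d × Fin N) (Fin r) ℝ) (Y : Matrix (Fin n) (Fin n) ℝ) :
    (Wᴴ * directSumCopies M N * W) ⊗ₖ Y =
      ∑ c, (copyBlock W c ⊗ₖ (1 : Matrix (Fin n) (Fin n) ℝ))ᴴ * (M ⊗ₖ Y) *
        (copyBlock W c ⊗ₖ (1 : Matrix (Fin n) (Fin n) ℝ)) := by
  rw [compress_directSumCopies]
  simp only [Matrix.conjTranspose_kronecker, ← Matrix.mul_kronecker_mul, Matrix.conjTranspose_one,
    Matrix.one_mul, Matrix.mul_one]
  ext p q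
  simp only [Matrix.kroneckerMap_apply, Matrix.sum_apply, Finset.sum_mul]

theorem linearPart_sumElim {ι κ m k : Type*} [Fintype ι] [Fintype κ]
    (A : ι → Matrix m m ℝ) (B : κ → Matrix m m ℝ)
    (X : ι → Matrix k k ℝ) (Y : κ → Matrix k k ℝ) :
    linearPart (Sum.elim A B) (Sum.elim X Y) = linearPart A X + linearPart B Y := by
  simp [linearPart, Fintype.sum_sum_type]

theorem linearPart_compression {ι : Type*} [Fintype ι] {d N r n : ℕ}
    (A : ι → Matrix (Fin d) (Fin d) ℝ) (W : Matrix (Fin d × Fin N) (Fin r) ℝ)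
    (X : ι → Matrix (Fin n) (Fin n) ℝ) :
    linearPart (compression A W) X =
      ∑ c, (copyBlock W c ⊗ₖ (1 : Matrix (Fin n) (Fin n) ℝ))ᴴ * linearPart A X *
        (copyBlock W c ⊗ₖ (1 : Matrix (Fin n) (Fin n) ℝ)) := by
  simp only [linearPart, compression, compress_kronecker, Matrix.mul_sum, Matrix.sum_mul]
  rw [Finset.sum_comm]

/-- Compressing a positive semidefinite pencil by a map that annihilates `B` eliminates the
variables `Y`. -/
theorem posSemidef_compression {g h d N r n : ℕ}
    {A : Fin g → Matrix (Fin d) (Fin d) ℝ} {B : Fin h → Matrix (Fin d) (Fin d) ℝ}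
    {X : Fin g → Matrix (Fin n) (Fin n) ℝ} (hX : X ∈ freeSpectrahedrop A B n)
    {W : Matrix (Fin d × Fin N) (Fin r) ℝ} (hW : compression B W = 0) :
    ((Wᴴ * W) ⊗ₖ (1 : Matrix (Fin n) (Fin n) ℝ)
      - linearPart (compression A W) X).PosSemidef := by
  obtain ⟨-, Y, -, -, hXY⟩ := hX
  have hB : linearPart (compression B W) Y = 0 := by simp [hW, linearPart]
  have h1 : (Wᴴ * W) ⊗ₖ (1 : Matrix (Fin n) (Fin n) ℝ) =
      ∑ c, (copyBlock W c ⊗ₖ (1 : Matrix (Fin n) (Fin n) ℝ))ᴴ *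
        ((1 : Matrix (Fin d) (Fin d) ℝ) ⊗ₖ (1 : Matrix (Fin n) (Fin n) ℝ)) *
        (copyBlock W c ⊗ₖ (1 : Matrix (Fin n) (Fin n) ℝ)) := by
    rw [← compress_kronecker, directSumCopies_one, Matrix.mul_one]
  rw [← sub_zero (_ - _), ← hB, h1, linearPart_compression, linearPart_compression,
    ← Finset.sum_sub_distrib, ← Finset.sum_sub_distrib]
  refine Matrix.posSemidef_sum _ fun c _ => ?_
  rw [← Matrix.sub_mul, ← Matrix.mul_sub, ← Matrix.sub_mul, ← Matrix.mul_sub, sub_sub,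
    ← linearPart_sumElim]
  exact hXY.conjTranspose_mul_mul_same _

theorem isHermitian_linearPart {ι m k : Type*} [Fintype ι]
    {A : ι → Matrix m m ℝ} {X : ι → Matrix k k ℝ}
    (hA : ∀ i, (A i).IsHermitian) (hX : ∀ i, (X i).IsHermitian) :
    (linearPart A X).IsHermitian := by
  simp only [Matrix.IsHermitian, linearPart, Matrix.conjTranspose_sum,
    Matrix.conjTranspose_kronecker]
  exact Finset.sum_congr rfl fun i _ => by rw [(hA i).eq, (hX i).eq]

/-! ### Conic duality up to `ε` -/

/-- A Hermitian matrix whose entries are small compared with `ε` is bounded below by `-ε`. -/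
theorem posSemidef_smul_one_add_of_abs_le {m : Type*} [Fintype m] [DecidableEq m]
    {E : Matrix m m ℝ} (hE : E.IsHermitian) {ε δ : ℝ} (hδ : δ * Fintype.card m ≤ ε)
    (h : ∀ i j, |E i j| ≤ δ) : (ε • (1 : Matrix m m ℝ) + E).PosSemidef := by
  refine Matrix.PosSemidef.of_dotProduct_mulVec_nonneg
    ((Matrix.isHermitian_one.smul (IsSelfAdjoint.all ε)).add hE) fun x => ?_
  have h1 : -(x ⬝ᵥ E *ᵥ x) ≤ ∑ i, ∑ j, δ * ((x i ^ 2 + x j ^ 2) / 2) := by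
    simp only [dotProduct, Matrix.mulVec, Finset.mul_sum, ← Finset.sum_neg_distrib]
    refine Finset.sum_le_sum fun i _ => Finset.sum_le_sum fun j _ => ?_
    calc -(x i * (E i j * x j)) ≤ |E i j| * (|x i| * |x j|) := by
          rw [← abs_mul, ← abs_mul]
          exact (neg_le_abs _).trans_eq (by ring_nf)
      _ ≤ δ * ((x i ^ 2 + x j ^ 2) / 2) := by
          refine mul_le_mul (h i j) ?_ (by positivity) ((abs_nonneg _).trans (h i j))
          nlinarith [sq_nonneg (|x i| - |x j|), sq_abs (x i), sq_abs (x j)]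
  have h2 : ∑ i, ∑ j, δ * ((x i ^ 2 + x j ^ 2) / 2) = δ * Fintype.card m * ∑ i, x i ^ 2 := by
    simp only [← Finset.mul_sum, ← Finset.sum_div, Finset.sum_add_distrib, Finset.sum_const,
      Finset.card_univ, nsmul_eq_mul]
    ring
  have h3 : x ⬝ᵥ x = ∑ i, x i ^ 2 := by simp [dotProduct, sq]
  have h4 : 0 ≤ ∑ i, x i ^ 2 := Finset.sum_nonneg fun i _ => sq_nonneg _
  rw [star_trivial, Matrix.add_mulVec, dotProduct_add, Matrix.smul_mulVec, Matrix.one_mulVec,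
    dotProduct_smul, smul_eq_mul, h3]
  nlinarith [mul_le_mul_of_nonneg_right hδ h4]

/-- A linear functional on matrices that is nonnegative on positive semidefinite matrices agrees,
on Hermitian matrices, with the trace pairing against a positive semidefinite matrix. -/
theorem exists_posSemidef_trace_eq {m : Type*} [Fintype m] [DecidableEq m]
    (f : Matrix m m ℝ →ₗ[ℝ] ℝ) (hf : ∀ P : Matrix m m ℝ, P.PosSemidef → 0 ≤ f P) :
    ∃ P : Matrix m m ℝ, P.PosSemidef ∧
      ∀ M : Matrix m m ℝ, M.IsHermitian → f M = (P * M).trace := by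
  let F : Matrix m m ℝ := Matrix.of fun i j => f (Matrix.single i j 1)
  have hF : ∀ M : Matrix m m ℝ, f M = ∑ i, ∑ j, M i j * F i j := by
    intro M
    conv_lhs => rw [Matrix.matrix_eq_sum_single M]
    simp only [map_sum]
    refine Finset.sum_congr rfl fun i _ => Finset.sum_congr rfl fun j _ => ?_
    rw [← mul_one (M i j), ← smul_eq_mul, ← Matrix.smul_single, map_smul]
    simp [F]
  -- Hermitian `M` only see the symmetric part of the coefficient matrix `F`.
  have hP : ∀ M : Matrix m m ℝ, M.IsHermitian →
      f M = ((((1 : ℝ) / 2) • (F + Fᴴ)) * M).trace := by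
    intro M hM
    have hM' : ∀ i j, M j i = M i j := fun i j => by simpa using hM.apply i j
    have e1 : (F * M).trace = f M := by
      rw [hF]
      simp only [Matrix.trace, Matrix.diag_apply, Matrix.mul_apply]
      exact Finset.sum_congr rfl fun i _ => Finset.sum_congr rfl fun j _ => by
        rw [hM' i j, mul_comm]
    have e2 : (Fᴴ * M).trace = f M := by
      rw [hF, Finset.sum_comm]
      simp only [Matrix.trace, Matrix.diag_apply, Matrix.mul_apply, Matrix.conjTranspose_apply,
        star_trivial]
      exact Finset.sum_congr rfl fun i _ => Finset.sum_congr rfl fun j _ => by rw [mul_comm]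
    rw [Matrix.smul_mul, Matrix.trace_smul, Matrix.add_mul, Matrix.trace_add, e1, e2, smul_eq_mul]
    ring
  refine ⟨_, Matrix.PosSemidef.of_dotProduct_mulVec_nonneg ?_ fun x => ?_, hP⟩
  · simp [Matrix.IsHermitian, add_comm]
  · have hx : (Matrix.vecMulVec x (star x)).PosSemidef := Matrix.posSemidef_vecMulVec_self_star x
    have := hf _ hx
    rwa [hP _ hx.1, Matrix.mul_vecMulVec, Matrix.trace_vecMulVec, dotProduct_comm] at this

/-- Theorem of alternatives for the cone spanned by the positive semidefinite matrices and a
subspace `S` of Hermitian matrices. -/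
theorem posSemidef_alternative {m : Type*} [Fintype m] [DecidableEq m]
    (S : Submodule ℝ (Matrix m m ℝ)) (hS : ∀ s ∈ S, s.IsHermitian)
    {M : Matrix m m ℝ} (hM : M.IsHermitian)
    (hdual : ∀ P : Matrix m m ℝ, P.PosSemidef → (∀ s ∈ S, (P * s).trace = 0) →
      0 ≤ (P * M).trace) {ε : ℝ} (hε : 0 < ε) :
    ∃ s ∈ S, (ε • (1 : Matrix m m ℝ) + M - s).PosSemidef := by
  let T : Set (Matrix m m ℝ) := {E | ∃ s ∈ S, (E - s).PosSemidef}
  have hadd : ∀ E ∈ T, ∀ E' ∈ T, E + E' ∈ T := by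
    rintro E ⟨s, hs, h⟩ E' ⟨s', hs', h'⟩
    exact ⟨s + s', S.add_mem hs hs', by simpa [add_sub_add_comm] using h.add h'⟩
  have hsmul : ∀ c : ℝ, 0 ≤ c → ∀ E ∈ T, c • E ∈ T := by
    rintro c hc E ⟨s, hs, h⟩
    exact ⟨c • s, S.smul_mem c hs, by simpa [smul_sub] using h.smul hc⟩
  have hST : ∀ s ∈ S, s ∈ T := fun s hs => ⟨s, hs, by simpa using Matrix.PosSemidef.zero⟩
  have hT : Convex ℝ T := fun E hE E' hE' a b ha hb _ =>
    hadd _ (hsmul a ha E hE) _ (hsmul b hb E' hE')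
  have : LocallyConvexSpace ℝ (Matrix m m ℝ) :=
    inferInstanceAs (LocallyConvexSpace ℝ (m → m → ℝ))
  by_cases hMT : M ∈ closure T
  · let δ : ℝ := ε / (Fintype.card m + 1)
    have hc : (0 : ℝ) < Fintype.card m + 1 := by positivity
    have hδ : 0 < δ := by positivity
    have hopen : IsOpen {E : Matrix m m ℝ | ∀ i j, |M i j - E i j| < δ} := by
      simp only [Set.ofPred_forall]
      refine isOpen_iInter_of_finite fun i => isOpen_iInter_of_finite fun j => ?_
      refine isOpen_lt ?_ continuous_const
      exact (continuous_const.sub (continuous_id.matrix_elem i j)).abs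
    obtain ⟨E, hE, s, hs, hEs⟩ := mem_closure_iff.mp hMT _ hopen (by simpa using fun _ _ => hδ)
    refine ⟨s, hs, ?_⟩
    have hEh : E.IsHermitian := by simpa using hEs.1.add (hS s hs)
    have hle : δ * Fintype.card m ≤ ε := by
      have : δ * (Fintype.card m + 1) = ε := div_mul_cancel₀ ε hc.ne'
      linarith
    have := (posSemidef_smul_one_add_of_abs_le (hM.sub hEh) hle fun i j => (hE i j).le).add hEs
    convert this using 1
    abel
  · exfalso
    obtain ⟨f, u, hfu, huM⟩ := geometric_hahn_banach_closed_point hT.closure isClosed_closure hMT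
    have hu : 0 < u := by simpa using hfu 0 (subset_closure (hST 0 S.zero_mem))
    have hneg : ∀ E ∈ T, f E ≤ 0 := by
      intro E hE
      -- `T` is a cone, so scaling `E` by `u / f E` would reach the value `u`, which `f` stays
      -- strictly below on `T`.
      by_contra! hpos
      have h := hfu _ (subset_closure (hsmul (u / f E) (by positivity) E hE))
      rw [map_smul, smul_eq_mul, div_mul_cancel₀ _ hpos.ne'] at h
      exact lt_irrefl _ h
    obtain ⟨P, hP, hfP⟩ := exists_posSemidef_trace_eq (-f.toLinearMap) fun P hP => by
      simpa using hneg P ⟨0, S.zero_mem, by simpa using hP⟩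
    have h0 : ∀ s ∈ S, (P * s).trace = 0 := by
      intro s hs
      rw [← hfP s (hS s hs)]
      have h1 := hneg s (hST s hs)
      have h2 := hneg (-s) (hST _ (S.neg_mem hs))
      rw [map_neg] at h2
      simp only [LinearMap.neg_apply, ContinuousLinearMap.coe_coe]
      linarith
    have := hdual P hP h0
    rw [← hfP M hM] at this
    simp only [LinearMap.neg_apply, ContinuousLinearMap.coe_coe] at this
    linarith

/-! ### Gram factors as compressions -/

/-- The map `ℝ^n → (ℝ^d)^N` obtained from a matrix `V` by distributing its rows over the copies
of `ℝ^d`. -/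
def copiesOfRows {d n N : ℕ} (V : Matrix (Fin N) (Fin d × Fin n) ℝ) :
    Matrix (Fin d × Fin N) (Fin n) ℝ :=
  Matrix.of fun p j => V p.2 (p.1, j)

/-- Each row of `V` is a `d × n` block of `copiesOfRows V`, so both traces are the same sum over
rows, except that `M` appears transposed; hence the symmetry of `M`. -/
theorem trace_gram_mul_kronecker {d n N : ℕ} (V : Matrix (Fin N) (Fin d × Fin n) ℝ)
    {M : Matrix (Fin d) (Fin d) ℝ} (hM : M.IsHermitian) (Y : Matrix (Fin n) (Fin n) ℝ) :
    (Vᴴ * V * (M ⊗ₖ Y)).trace =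
      ((copiesOfRows V)ᴴ * directSumCopies M N * copiesOfRows V * Y).trace := by
  have hM' : ∀ a b, M b a = M a b := fun a b => by simpa using hM.apply a b
  rw [compress_directSumCopies]
  simp only [Matrix.trace, Matrix.diag_apply, Matrix.mul_apply, Matrix.sum_apply,
    Matrix.conjTranspose_apply, star_trivial, copyBlock, copiesOfRows, Matrix.of_apply,
    Fintype.sum_prod_type, Matrix.kroneckerMap_apply, Finset.sum_mul]
  rw [Finset.sum_comm]
  refine Finset.sum_congr rfl fun j _ => ?_
  calc ∑ a, ∑ b, ∑ k, ∑ c, V c (a, j) * V c (b, k) * (M b a * Y k j)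
      = ∑ a, ∑ k, ∑ b, ∑ c, V c (a, j) * V c (b, k) * (M b a * Y k j) :=
        Finset.sum_congr rfl fun a _ => Finset.sum_comm
    _ = ∑ k, ∑ a, ∑ b, ∑ c, V c (a, j) * V c (b, k) * (M b a * Y k j) := Finset.sum_comm
    _ = ∑ k, ∑ b, ∑ a, ∑ c, V c (a, j) * V c (b, k) * (M b a * Y k j) :=
        Finset.sum_congr rfl fun k _ => Finset.sum_comm
    _ = ∑ k, ∑ b, ∑ c, ∑ a, V c (a, j) * V c (b, k) * (M b a * Y k j) :=
        Finset.sum_congr rfl fun k _ => Finset.sum_congr rfl fun b _ => Finset.sum_comm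
    _ = ∑ k, ∑ c, ∑ b, ∑ a, V c (a, j) * V c (b, k) * (M b a * Y k j) :=
        Finset.sum_congr rfl fun k _ => Finset.sum_comm
    _ = _ := by
        rw [Finset.sum_comm]
        refine Finset.sum_congr rfl fun c _ => Finset.sum_congr rfl fun k _ =>
          Finset.sum_congr rfl fun b _ => Finset.sum_congr rfl fun a _ => ?_
        rw [hM' a b]
        ring

/-- At `∑ e_j ⊗ e_j` the form equals `∑ C_jk Y_jk`, which is the trace since `Y` is symmetric. -/
theorem dotProduct_kronecker_mulVec_diag {n : ℕ} (C Y : Matrix (Fin n) (Fin n) ℝ)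
    (hY : Y.IsHermitian) :
    (fun p : Fin n × Fin n => (1 : Matrix (Fin n) (Fin n) ℝ) p.1 p.2) ⬝ᵥ
      (C ⊗ₖ Y) *ᵥ (fun p : Fin n × Fin n => (1 : Matrix (Fin n) (Fin n) ℝ) p.1 p.2) =
      (C * Y).trace := by
  have hY' : ∀ a b, Y b a = Y a b := fun a b => by simpa using hY.apply a b
  simp [dotProduct, Matrix.mulVec, Matrix.trace, Matrix.mul_apply, Fintype.sum_prod_type,
    Matrix.one_apply, hY']

theorem compression_isHermitian {d N r : ℕ} {M : Matrix (Fin d) (Fin d) ℝ} (hM : M.IsHermitian)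
    (W : Matrix (Fin d × Fin N) (Fin r) ℝ) : (Wᴴ * directSumCopies M N * W).IsHermitian := by
  refine Matrix.isHermitian_conjTranspose_mul_mul W ?_
  rw [Matrix.IsHermitian, directSumCopies, Matrix.blockDiagonal_conjTranspose, hM.eq]

theorem trace_gram_mul_linearPart {ι : Type*} [Fintype ι] {d n N : ℕ}
    (V : Matrix (Fin N) (Fin d × Fin n) ℝ) {A : ι → Matrix (Fin d) (Fin d) ℝ}
    (hA : ∀ i, (A i).IsHermitian) (X : ι → Matrix (Fin n) (Fin n) ℝ) :
    (Vᴴ * V * linearPart A X).trace =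
      ∑ i, (compression A (copiesOfRows V) i * X i).trace := by
  simp only [linearPart, Matrix.mul_sum, Matrix.trace_sum]
  exact Finset.sum_congr rfl fun i _ => trace_gram_mul_kronecker V (hA i) (X i)

/-- The values of the pencil `Λ_B` at tuples of self-adjoint matrices. -/
def linearPartRange {h d : ℕ} (B : Fin h → Matrix (Fin d) (Fin d) ℝ) (n : ℕ) :
    Submodule ℝ (Matrix (Fin d × Fin n) (Fin d × Fin n) ℝ) where
  carrier := {s | ∃ Y ∈ selfAdjointTuples (Fin h) n, linearPart B Y = s}
  add_mem' := by
    rintro _ _ ⟨Y, hY, rfl⟩ ⟨Y', hY', rfl⟩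
    exact ⟨Y + Y', fun i => (hY i).add (hY' i),
      by simp [linearPart, Matrix.kronecker_add, Finset.sum_add_distrib]⟩
  zero_mem' := ⟨0, fun _ => Matrix.isHermitian_zero, by simp [linearPart]⟩
  smul_mem' := by
    rintro c _ ⟨Y, hY, rfl⟩
    exact ⟨c • Y, fun i => (hY i).smul (IsSelfAdjoint.all c),
      by simp [linearPart, Matrix.kronecker_smul, Finset.smul_sum]⟩

-- The rows of a square root may be relabelled freely; this makes `n d` copies of `ℝ^d` enough.
open scoped MatrixOrder Matrix.Norms.L2Operator in
theorem exists_eq_conjTranspose_mul_self_of_posSemidef {m k : Type*} [Fintype m] [DecidableEq m]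
    [Fintype k] (e : m ≃ k) {P : Matrix m m ℝ} (hP : P.PosSemidef) :
    ∃ V : Matrix k m ℝ, P = Vᴴ * V := by
  obtain ⟨V, rfl⟩ := CStarAlgebra.nonneg_iff_eq_star_mul_self.mp hP.nonneg
  exact ⟨V.submatrix e.symm id, by
    rw [Matrix.conjTranspose_submatrix, Matrix.submatrix_mul_equiv, Matrix.submatrix_id_id,
      Matrix.star_eq_conjTranspose]⟩

/-! ### Membership from the compressed inequalities -/

/-- If all compressions by elements of `Z_B(n)` are positive semidefinite at `X`, then
`(1 + ε)⁻¹ X` lies in the spectrahedrop for every `ε > 0`. -/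
theorem inv_smul_mem_freeSpectrahedrop {g h d n : ℕ}
    {A : Fin g → Matrix (Fin d) (Fin d) ℝ} {B : Fin h → Matrix (Fin d) (Fin d) ℝ}
    (hA : A ∈ selfAdjointTuples (Fin g) d) (hB : B ∈ selfAdjointTuples (Fin h) d)
    {X : Fin g → Matrix (Fin n) (Fin n) ℝ} (hX : X ∈ selfAdjointTuples (Fin g) n)
    (hW : ∀ W ∈ setZ B n,
      ((Wᴴ * W) ⊗ₖ (1 : Matrix (Fin n) (Fin n) ℝ)
        - linearPart (compression A W) X).PosSemidef) {ε : ℝ} (hε : 0 < ε) :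
    (1 + ε)⁻¹ • X ∈ freeSpectrahedrop A B n := by
  have h1X : (monicPencil A X).IsHermitian := by
    rw [monicPencil, Matrix.one_kronecker_one]
    exact Matrix.isHermitian_one.sub (isHermitian_linearPart hA hX)
  obtain ⟨_, ⟨Y, hY, rfl⟩, hpos⟩ := posSemidef_alternative (linearPartRange B n)
    (by rintro _ ⟨Y, hY, rfl⟩; exact isHermitian_linearPart hB hY) h1X (fun P hP hPB => by
      obtain ⟨V, rfl⟩ := exists_eq_conjTranspose_mul_self_of_posSemidef
        ((Equiv.prodComm (Fin d) (Fin n)).trans finProdFinEquiv) hP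
      have hWB : copiesOfRows V ∈ setZ B n := by
        -- Orthogonality is tested at `Y = Q` itself, which gives `∑ tr(Q_i²) = 0` and so `Q = 0`.
        let Q := compression B (copiesOfRows V)
        have hQ : ∀ i, (Q i).IsHermitian := fun i => compression_isHermitian (hB i) _
        have h0 := hPB _ ⟨Q, hQ, rfl⟩
        rw [trace_gram_mul_linearPart V hB] at h0
        have hnn : ∀ i, 0 ≤ (Q i * Q i).trace := fun i => by
          have := (Matrix.posSemidef_conjTranspose_mul_self (Q i)).trace_nonneg
          rwa [(hQ i).eq] at this
        funext i
        have hi := (Finset.sum_eq_zero_iff_of_nonneg fun i _ => hnn i).mp h0 i (Finset.mem_univ i)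
        refine Matrix.trace_conjTranspose_mul_self_eq_zero_iff.mp ?_
        rw [(hQ i).eq]
        exact hi
      have hval := (hW _ hWB).dotProduct_mulVec_nonneg
        (fun p : Fin n × Fin n => (1 : Matrix (Fin n) (Fin n) ℝ) p.1 p.2)
      rw [star_trivial, Matrix.sub_mulVec, dotProduct_sub, linearPart, Matrix.sum_mulVec,
        dotProduct_sum, dotProduct_kronecker_mulVec_diag _ _ Matrix.isHermitian_one,
        Finset.sum_congr rfl fun i _ => dotProduct_kronecker_mulVec_diag _ _ (hX i)] at hval
      rw [monicPencil, Matrix.mul_sub, Matrix.trace_sub, trace_gram_mul_linearPart V hA,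
        trace_gram_mul_kronecker V Matrix.isHermitian_one, directSumCopies_one, Matrix.mul_one,
        Matrix.mul_one]
      rwa [Matrix.mul_one] at hval) hε
  have hε' : (0 : ℝ) < 1 + ε := by linarith
  have hXs : (1 + ε)⁻¹ • X ∈ selfAdjointTuples (Fin g) n :=
    fun i => (hX i).smul (k := (1 + ε)⁻¹) (IsSelfAdjoint.all _)
  have hYs : (1 + ε)⁻¹ • Y ∈ selfAdjointTuples (Fin h) n :=
    fun i => (hY i).smul (k := (1 + ε)⁻¹) (IsSelfAdjoint.all _)
  refine ⟨hXs, _, hYs, Sum.rec hXs hYs, ?_⟩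
  -- Dividing `(1 + ε) I - Λ_A(X) - Λ_B(Y) ⪰ 0` by `1 + ε` makes the pencil monic again.
  convert hpos.smul (inv_nonneg.mpr hε'.le) using 1
  have hlin : ∀ {k : ℕ} (C : Fin k → Matrix (Fin d) (Fin d) ℝ) (Z : Fin k → Matrix (Fin n) (Fin n) ℝ),
      linearPart C ((1 + ε)⁻¹ • Z) = (1 + ε)⁻¹ • linearPart C Z := fun C Z => by
    simp [linearPart, Matrix.kronecker_smul, Finset.smul_sum]
  have hone : (1 : Matrix (Fin d × Fin n) (Fin d × Fin n) ℝ) =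
      (1 + ε)⁻¹ • ((1 + ε) • (1 : Matrix (Fin d × Fin n) (Fin d × Fin n) ℝ)) := by
    rw [smul_smul, inv_mul_cancel₀ hε'.ne', one_smul]
  rw [monicPencil, monicPencil, linearPart_sumElim, hlin, hlin, Matrix.one_kronecker_one]
  conv_lhs => rw [hone]
  rw [← smul_add, ← smul_sub, add_smul, one_smul]
  congr 1
  abel

theorem mem_freeSpectrahedrop_of_forall_setZ {g h d n : ℕ}
    {A : Fin g → Matrix (Fin d) (Fin d) ℝ} {B : Fin h → Matrix (Fin d) (Fin d) ℝ}
    (hA : A ∈ selfAdjointTuples (Fin g) d) (hB : B ∈ selfAdjointTuples (Fin h) d)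
    (hclosed : IsFreeClosed (freeSpectrahedrop A B))
    {X : Fin g → Matrix (Fin n) (Fin n) ℝ} (hX : X ∈ selfAdjointTuples (Fin g) n)
    (hW : ∀ W ∈ setZ B n,
      ((Wᴴ * W) ⊗ₖ (1 : Matrix (Fin n) (Fin n) ℝ)
        - linearPart (compression A W) X).PosSemidef) :
    X ∈ freeSpectrahedrop A B n := by
  have hmem := fun ε (hε : 0 < ε) => inv_smul_mem_freeSpectrahedrop hA hB hX hW (ε := ε) hε
  rcases Nat.eq_zero_or_pos n with rfl | hn
  -- Closedness is only available for `n > 0`; at `n = 0` all tuples coincide.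
  · convert hmem 1 one_pos using 1
    exact funext fun i => Subsingleton.elim _ _
  · have hcont : ContinuousAt (fun ε : ℝ => (1 + ε)⁻¹ • X) 0 :=
      ((continuousAt_const.add continuousAt_id).inv₀ (by norm_num)).smul continuousAt_const
    have hlim := hcont.tendsto.mono_left (nhdsWithin_le_nhds (s := Set.Ioi 0))
    simp only [add_zero, inv_one, one_smul] at hlim
    exact (hclosed n hn).mem_of_tendsto hlim
      (Filter.eventually_of_mem self_mem_nhdsWithin fun ε hε => hmem ε hε)

/-! ### Reduction to isometries -/

/-- Every matrix with `n` columns factors as `U * S` with `U` an isometry on at most `n`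
dimensions whose columns are combinations of the columns of the matrix. -/
theorem exists_isometry_factorization {m : Type*} [Fintype m] [DecidableEq m] {n : ℕ}
    (W : Matrix m (Fin n) ℝ) :
    ∃ r ≤ n, ∃ (U : Matrix m (Fin r) ℝ) (S : Matrix (Fin r) (Fin n) ℝ)
      (T : Matrix (Fin n) (Fin r) ℝ), Uᴴ * U = 1 ∧ W = U * S ∧ U = W * T := by
  let w : Fin n → EuclideanSpace ℝ m := fun j => WithLp.toLp 2 fun i => W i j
  let R : Submodule ℝ (EuclideanSpace ℝ m) := Submodule.span ℝ (Set.range w)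
  obtain ⟨r, hr, ⟨b⟩⟩ : ∃ r ≤ n, Nonempty (OrthonormalBasis (Fin r) ℝ R) :=
    ⟨Module.finrank ℝ R, (finrank_range_le_card (R := ℝ) w).trans_eq (Fintype.card_fin n),
      ⟨stdOrthonormalBasis ℝ R⟩⟩
  have hT : ∀ k, ∃ c : Fin n → ℝ, ∑ j, c j • w j = (b k : EuclideanSpace ℝ m) := fun k =>
    (Submodule.mem_span_range_iff_exists_fun ℝ).mp (b k).2
  choose c hc using hT
  refine ⟨r, hr,
    Matrix.of fun i k => (b k : EuclideanSpace ℝ m) i,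
    Matrix.of fun k j => b.repr ⟨w j, Submodule.subset_span ⟨j, rfl⟩⟩ k,
    Matrix.of fun j k => c k j, ?_, ?_, ?_⟩
  · ext k l
    have := orthonormal_iff_ite.mp b.orthonormal k l
    rw [Submodule.coe_inner, PiLp.inner_apply] at this
    simpa [Matrix.mul_apply, Matrix.one_apply, mul_comm] using this
  · ext i j
    have h := congrArg (fun v : R => (v : EuclideanSpace ℝ m) i)
      (b.sum_repr ⟨w j, Submodule.subset_span ⟨j, rfl⟩⟩)
    simp only [Submodule.coe_sum, Submodule.coe_smul, WithLp.ofLp_sum, Finset.sum_apply,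
      PiLp.smul_apply, smul_eq_mul] at h
    simp only [Matrix.mul_apply, Matrix.of_apply]
    rw [← show w j i = W i j from rfl, ← h]
    exact Finset.sum_congr rfl fun k _ => mul_comm _ _
  · ext i k
    have h := congrArg (fun v : EuclideanSpace ℝ m => v i) (hc k)
    simp only [WithLp.ofLp_sum, Finset.sum_apply, PiLp.smul_apply, smul_eq_mul] at h
    simp only [Matrix.mul_apply, Matrix.of_apply]
    rw [← h]
    exact Finset.sum_congr rfl fun k _ => mul_comm _ _

theorem compression_mul {ι : Type*} {d N r s : ℕ} (A : ι → Matrix (Fin d) (Fin d) ℝ)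
    (W : Matrix (Fin d × Fin N) (Fin r) ℝ) (S : Matrix (Fin r) (Fin s) ℝ) :
    compression A (W * S) = fun i => Sᴴ * compression A W i * S := by
  funext i
  simp only [compression, Matrix.conjTranspose_mul, Matrix.mul_assoc]

theorem forall_setZ_of_forall_setIUnion {g h d n k : ℕ}
    {A : Fin g → Matrix (Fin d) (Fin d) ℝ} {B : Fin h → Matrix (Fin d) (Fin d) ℝ}
    {X : Fin g → Matrix (Fin k) (Fin k) ℝ}
    (hX : ∀ W ∈ setIUnion B n, (monicPencil (compression A W.2) X).PosSemidef) :
    ∀ W ∈ setZ B n, ((Wᴴ * W) ⊗ₖ (1 : Matrix (Fin k) (Fin k) ℝ)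
        - linearPart (compression A W) X).PosSemidef := by
  intro W hW
  obtain ⟨r, hr, U, S, T, hU, hWU, hUW⟩ := exists_isometry_factorization W
  -- `U = W * T` carries the vanishing of the compression of `B` from `W` to `U`; `W = U * S` then
  -- carries positivity back.
  have hUB : compression B U = 0 := by
    rw [hUW, compression_mul, show compression B W = 0 from hW]
    funext i
    simp
  have hpos := (hX ⟨r, U⟩ ⟨hr, hUB, hU⟩).conjTranspose_mul_mul_same
    (S ⊗ₖ (1 : Matrix (Fin k) (Fin k) ℝ))
  convert hpos using 1
  rw [hWU, compression_mul, Matrix.conjTranspose_mul, Matrix.mul_assoc, ← Matrix.mul_assoc Uᴴ, hU,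
    Matrix.one_mul]
  simp only [monicPencil, linearPart, Matrix.mul_sub, Matrix.sub_mul, Matrix.mul_sum,
    Matrix.sum_mul, Matrix.conjTranspose_kronecker, ← Matrix.mul_kronecker_mul,
    Matrix.conjTranspose_one, Matrix.one_mul, Matrix.mul_one]

theorem theorem2p1 {g h d : ℕ}
    (A : Fin g → Matrix (Fin d) (Fin d) ℝ) (B : Fin h → Matrix (Fin d) (Fin d) ℝ)
    (hA : A ∈ selfAdjointTuples (Fin g) d) (hB : B ∈ selfAdjointTuples (Fin h) d)
    (hclosed : IsFreeClosed (freeSpectrahedrop A B))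
    (hbounded : IsFreeBounded (freeSpectrahedrop A B))
    (n : ℕ) (X : Fin g → Matrix (Fin n) (Fin n) ℝ) (hX : X ∈ selfAdjointTuples (Fin g) n) :
    (X ∈ freeSpectrahedrop A B n ↔
      ∀ W ∈ setZ B n,
        ((Wᴴ * W) ⊗ₖ (1 : Matrix (Fin n) (Fin n) ℝ)
          - linearPart (compression A W) X).PosSemidef) ∧
    (X ∈ freeSpectrahedrop A B n ↔
      ∀ W ∈ setIUnion B n, (monicPencil (compression A W.2) X).PosSemidef) ∧
    (X ∈ freeSpectrahedrop A B n →
      ∀ m : ℕ, ∀ W ∈ setIUnion B m, (monicPencil (compression A W.2) X).PosSemidef) := by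
  have hfwd : X ∈ freeSpectrahedrop A B n →
      ∀ m : ℕ, ∀ W ∈ setIUnion B m, (monicPencil (compression A W.2) X).PosSemidef := by
    rintro hmem m ⟨r, W⟩ ⟨-, hWB, hWW⟩
    have := posSemidef_compression hmem hWB
    rwa [hWW] at this
  have hZ := mem_freeSpectrahedrop_of_forall_setZ hA hB hclosed hX
  exact ⟨⟨fun hmem W hW => posSemidef_compression hmem hW, hZ⟩,
    ⟨fun hmem => hfwd hmem n, fun hI => hZ (forall_setZ_of_forall_setIUnion hI)⟩, hfwd⟩
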